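/- Let $\mathbb Z'=\mathbb Z+\frac12$, let $\mathbb Z'_+$ and $\mathbb Z'_-$ be its subsets of positive and negative elements, and let $H=\ell^2(\mathbb Z')=H_+\oplus H_-$ with $H_\pm=\ell^2(\mathbb Z'_\pm)$ and natural orthonormal basis $\{e_x\}$. A bounded operator $A$ on $H$ has the kernel $A(x,y)=(Ae_y,e_x)$ and the blocks $A_{++},A_{+-},A_{-+},A_{--}$. Let $\mathcal L(H)$ be the set of bounded operators $A$ on $H$ for which $A_{++}$, $A_{--}$ are of trace class and $A_{+-}$, $A_{-+}$ are Hilbert–Schmidt. For $A\in\mathcal L(H)$ the operator $(1+A)e^{-A}-1$ is of trace class, and one sets $$\det(1+A)=\det\big((1+A)e^{-A}\big)\,e^{\operatorname{tr}(A_{++})+\operatorname{tr}(A_{--})},$$ where the determinant on the right is the conventional Fredholm determinant. Let $\operatorname{Conf}(\mathbb Z')$ be the space of all subsets of $\mathbb Z'$, identified with $\{0,1\}^{\mathbb Z'}$, with its Borel structure. Let $P$ be a determinantal probability measure on $\operatorname{Conf}(\mathbb Z')$ with correlation kernel $K(x,y)$ corresponding to a bounded operator $K$ on $H$; that is, for every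 finite $S\subset\mathbb Z'$, $$P\{X: S\subseteq X\}=\det[K(x,y)]_{x,y\in S}.$$ Let $f$ be a complex-valued function on $\mathbb Z'$ of the form $f(x)=g(x)h(x)^2$, where $g$ is bounded and complex-valued, $h\ge 0$, and $A_hKA_h\in\mathcal L(H)$. Here $A_\varphi$ denotes multiplication by $\varphi$, and for unbounded $h$ the condition means that some operator in $\mathcal L(H)$, denoted $A_hKA_h$, has the kernel $h(x)K(x,y)h(y)$. Then the product $\Phi_f(X)=\prod_{x\in X}(1+f(x))$ converges absolutely, in the sense that $\sum_{x\in X}|f(x)|<\infty$, for $P$-almost every $X$; the function $\Phi_f$ is absolutely integrable with respect to $P$; and $$\mathbb E_P(\Phi_f)=\det(1+A_gA_hKA_h).$$ -/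

import Mathlib

open MeasureTheory

namespace DetMeasure

noncomputable section

/-- The lattice `ℤ' = ℤ + 1/2` of half-integers. -/
abbrev HalfInt : Type := {x : ℚ // ∃ n : ℤ, x = n + 1 / 2}

/-- The space `Conf(𝔛)` of configurations in a countable set `𝔛`: all subsets of `𝔛`.
The instance found by Lean on `Set ι` is the product σ-algebra of `{0,1}^𝔛`; since `𝔛` is
countable it is the Borel σ-algebra of the product topology. -/
abbrev Conf (ι : Type) : Type := Set ι

/-- The Hilbert space `ℓ²(𝔛)`. -/
abbrev L2 (ι : Type) : Type := lp (fun _ : ι => ℂ) 2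

section Generic

variable {ι : Type}

/-- The natural basis vector `e_x` of `ℓ²(𝔛)`. -/
def e [DecidableEq ι] (x : ι) : L2 ι := lp.single 2 x 1

/-- The kernel (matrix) `A(x,y) = (A e_y, e_x)` of a bounded operator on `ℓ²(𝔛)`, that is, the
`x`-coordinate of `A e_y`. -/
def kernel [DecidableEq ι] (A : L2 ι →L[ℂ] L2 ι) (x y : ι) : ℂ := (A (e y)) x

/-- `P` is determinantal with correlation operator `K`: for every finite set `S` of points,
the probability that the random configuration contains `S` is the principal minor
`det [K(x,y)]_{x,y ∈ S}`. -/
def IsDeterminantal [DecidableEq ι] (P : Measure (Conf ι)) (K : L2 ι →L[ℂ] L2 ι) : Prop :=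
  ∀ S : Finset ι,
    ((P.real {X : Conf ι | (S : Set ι) ⊆ X} : ℝ) : ℂ) =
      (Matrix.of fun x y : S => kernel K x y).det

/-- `Φ_f` is defined at the configuration `X`: the product `∏_{x ∈ X} (1 + f(x))` converges
absolutely, that is, `∑_{x ∈ X} |f(x)| < ∞`. -/
def PhiDefinedAt (f : ι → ℂ) (X : Conf ι) : Prop :=
  Summable fun x : X => ‖f x‖

/-- The multiplicative functional `Φ_f(X) = ∏_{x ∈ X} (1 + f(x))`. It is meaningful on the set
where `PhiDefinedAt f X` holds. -/
def Phi (f : ι → ℂ) (X : Conf ι) : ℂ :=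
  ∏' x : X, (1 + f x)

/-- A bounded function times a square-summable one is square-summable. -/
theorem memℓp_mul (g : ι → ℂ) {C : ℝ} (hC : ∀ x, ‖g x‖ ≤ C) (v : L2 ι) :
    Memℓp (fun x => g x * v x) 2 := by
  have h2 : (0 : ℝ) < (2 : ENNReal).toReal := by norm_num
  refine memℓp_gen ?_
  refine Summable.of_nonneg_of_le (fun x => by positivity) (fun x => ?_)
    (((lp.memℓp v).summable h2).mul_left (C ^ (2 : ENNReal).toReal))
  have hC0 : 0 ≤ C := (norm_nonneg _).trans (hC x)
  rw [norm_mul, Real.mul_rpow (norm_nonneg _) (norm_nonneg _)]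
  gcongr
  exact hC x

/-- The operator `A_g` on `ℓ²(𝔛)` of multiplication by a bounded function `g`. -/
def mulOp (g : ι → ℂ) (hg : ∃ C : ℝ, ∀ x, ‖g x‖ ≤ C) : L2 ι →L[ℂ] L2 ι :=
  LinearMap.mkContinuousOfExistsBound
    { toFun := fun v => ⟨fun x => g x * v x, memℓp_mul g hg.choose_spec v⟩
      map_add' := fun v w => by
        ext x
        exact mul_add _ _ _
      map_smul' := fun c v => by
        ext x
        exact mul_left_comm _ _ _ }
    (by
      obtain ⟨C, hC⟩ := hg
      refine ⟨max C 0, fun v => ?_⟩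
      have h2 : (0 : ℝ) < (2 : ENNReal).toReal := by norm_num
      refine lp.norm_le_of_forall_sum_le h2 (by positivity) (fun s => ?_)
      rw [Real.mul_rpow (le_max_right _ _) (norm_nonneg _)]
      refine le_trans ?_ (mul_le_mul_of_nonneg_left (lp.sum_rpow_le_norm_rpow h2 v s)
        (by positivity))
      rw [Finset.mul_sum]
      refine Finset.sum_le_sum fun x _ => ?_
      change ‖g x * v x‖ ^ _ ≤ _
      rw [norm_mul, Real.mul_rpow (norm_nonneg _) (norm_nonneg _)]
      gcongr
      exact (hC x).trans (le_max_left _ _))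

@[simp] theorem mulOp_apply (g : ι → ℂ) (hg : ∃ C : ℝ, ∀ x, ‖g x‖ ≤ C) (v : L2 ι) (x : ι) :
    (mulOp g hg v) x = g x * v x := rfl

/-- The bounded operator `B` is `A_h K A_h`, that is, its kernel is `h(x) K(x,y) h(y)`.
The function `h` may be unbounded: then `B` is the bounded operator which agrees with the
product of the (unbounded) operators `A_h`, `K`, `A_h` on finitely supported vectors.
At most one bounded operator `B` has this property. -/
def IsSandwich [DecidableEq ι] (h : ι → ℝ) (K B : L2 ι →L[ℂ] L2 ι) : Prop :=
  ∀ x y, kernel B x y = h x * kernel K x y * h y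

/-- For bounded `h`, being `A_h K A_h` in the above sense is the equality `B = A_h K A_h` of
bounded operators. -/
theorem isSandwich_iff [DecidableEq ι] (h : ι → ℝ) (hh : ∃ C : ℝ, ∀ x, ‖(h x : ℂ)‖ ≤ C)
    (K B : L2 ι →L[ℂ] L2 ι) :
    IsSandwich h K B ↔
      B = mulOp (fun x => (h x : ℂ)) hh * K * mulOp (fun x => (h x : ℂ)) hh := by
  have key : ∀ y, mulOp (fun x => (h x : ℂ)) hh (e y) = (h y : ℂ) • e y := by
    intro y
    ext x
    by_cases hxy : x = y
    · subst hxy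
      simp [e, -Complex.coe_smul]
    · simp [e, hxy, -Complex.coe_smul]
  constructor
  · intro hB
    refine lp.ext_continuousLinearMap (by norm_num) fun y => ?_
    ext x
    have := hB x y
    simp only [kernel] at this
    change (B (e y)) x = (mulOp _ hh (K (mulOp _ hh (e y)))) x
    rw [key, this]
    simp [mul_comm, -Complex.coe_smul]
  · rintro rfl x y
    simp only [kernel]
    change (mulOp _ hh (K (mulOp _ hh (e y)))) x = _
    rw [key]
    simp [mul_comm, -Complex.coe_smul]

/-- Hilbert–Schmidt operators on `ℓ²(𝔛)`: `∑_x ‖A e_x‖² < ∞` (independent of the orthonormal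
basis). -/
def IsHilbertSchmidt [DecidableEq ι] (A : L2 ι →L[ℂ] L2 ι) : Prop :=
  Summable fun x : ι => ‖A (e x)‖ ^ 2

/-- The absolute value `|A| = (A* A)^{1/2}` of a bounded operator on a complex Hilbert space. -/
def absOp {E : Type} [NormedAddCommGroup E] [InnerProductSpace ℂ E] [CompleteSpace E]
    (A : E →L[ℂ] E) : E →L[ℂ] E := CFC.abs A

/-- Trace class operators on `ℓ²(𝔛)`: `tr |A| = ∑_x (|A| e_x, e_x) < ∞`, where
`|A| = (A* A)^{1/2}` (independent of the orthonormal basis). -/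
def IsTraceClass [DecidableEq ι] (A : L2 ι →L[ℂ] L2 ι) : Prop :=
  Summable fun x : ι => (kernel (absOp A) x x).re

/-- The trace `∑_x (A e_x, e_x)`; the sum converges absolutely for trace class `A`. -/
def trace [DecidableEq ι] (A : L2 ι →L[ℂ] L2 ι) : ℂ := ∑' x : ι, kernel A x x

/-- The conventional (Fredholm) determinant `det(1 + T)` of a trace class operator `T`:
the Fredholm series `∑_n (1/n!) ∑_{x₁,…,xₙ} det [T(x_i,x_j)]`, which is the sum of all finite
principal minors of the kernel of `T`. -/
def fredholmDet [DecidableEq ι] (T : L2 ι →L[ℂ] L2 ι) : ℂ :=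
  ∑' S : Finset ι, (Matrix.of fun x y : S => kernel T x y).det

open scoped Classical in
/-- The orthogonal projection of `ℓ²(𝔛)` onto the subspace `ℓ²(Y)`, for `Y ⊆ 𝔛`. -/
def proj (Y : Set ι) : L2 ι →L[ℂ] L2 ι :=
  mulOp (fun x => if x ∈ Y then 1 else 0) ⟨1, fun x => by split_ifs <;> simp⟩

/-- The block of `A` acting from `ℓ²(Z)` to `ℓ²(Y)`, regarded as an operator on the whole of
`ℓ²(𝔛)` that vanishes on the orthogonal complement of `ℓ²(Z)`. -/
def block (Y Z : Set ι) (A : L2 ι →L[ℂ] L2 ι) : L2 ι →L[ℂ] L2 ι := proj Y * A * proj Z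

end Generic

/-- The Hilbert space `H = ℓ²(ℤ')`. -/
abbrev H : Type := L2 HalfInt

/-- The set `ℤ'₊` of positive half-integers. -/
def posHalf : Set HalfInt := {x | 0 < x.1}

/-- The set `ℤ'₋` of negative half-integers. -/
def negHalf : Set HalfInt := {x | x.1 < 0}

/-- The class `𝓛(H)`, with respect to the grading `H = ℓ²(ℤ'₊) ⊕ ℓ²(ℤ'₋)`: bounded operators
whose diagonal blocks are trace class and whose off-diagonal blocks are Hilbert–Schmidt. -/
structure MemLL (A : H →L[ℂ] H) : Prop where
  pos_pos : IsTraceClass (block posHalf posHalf A)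
  neg_neg : IsTraceClass (block negHalf negHalf A)
  pos_neg : IsHilbertSchmidt (block posHalf negHalf A)
  neg_pos : IsHilbertSchmidt (block negHalf posHalf A)

/-- The extended determinant `det(1 + A)` for `A ∈ 𝓛(H)`:
`det(1 + A) = det((1 + A) e^{-A}) · e^{tr A₊₊ + tr A₋₋}`,
the determinant on the right being the conventional one (the operator `(1 + A) e^{-A} - 1` is
trace class). -/
def detOneAdd (A : H →L[ℂ] H) : ℂ :=
  fredholmDet ((1 + A) * NormedSpace.exp (-A) - 1) *
    Complex.exp (trace (block posHalf posHalf A) + trace (block negHalf negHalf A))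

end

end DetMeasure

/-!
For finitely many points the identity is the expansion of a product: the expectation of
`∏_{x ∈ X ∩ F} (1 + f x)` is the sum over `S ⊆ F` of `∏_{x ∈ S} f x` times the probability of
`S ⊆ X`. By the determinantal property and `f = g h²` the term of index `S` is a principal minor
of `A = A_g A_h K A_h`, so the sum is `det (1 + A_F)` for the finite truncation `A_F` of `A`. The
work is the passage to the limit over the finite sets `F`.

Membership of `B = A_h K A_h` in `𝓛(H)` is used through two consequences only: `B` is
Hilbert–Schmidt and its diagonal is absolutely summable (`IsTraceClass.exists_eq_mul` writes a
trace class block as a product of two Hilbert–Schmidt operators). Both pass to `A`.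

The regularised part converges because `(1 + z) e^{-z} - 1` has a double zero at the origin, so
`(1 + A) e^{-A} - 1 = A Ψ A` with `‖Ψ‖ ≤ e^{‖A‖}` (`exists_regPart_eq`). Its kernel consists of
inner products of the vectors `A* e_x` and `Ψ A e_y`, and Hadamard's inequality
(`norm_det_inner_le`) bounds the principal minor on `S` by `∏_{x ∈ S} e^{‖A‖} ‖A* e_x‖ ‖A e_x‖`.
This is summable over all finite `S` because `∑_x ‖A* e_x‖ ‖A e_x‖ < ∞`, and the same bound serves
every truncation. The truncations converge to `A` in norm, so dominated convergence gives
convergence of the Fredholm series (`IsHilbertSchmidt.tendsto_fredholmDet_regPart`). For a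
truncation, `det e^M = e^{tr M}` turns the regularised determinant into
`det (1 + A_F) e^{-tr A_F}` (`fredholmDet_regPart_block`), and `tr A_F` converges to the sum of
the diagonal. Hence `det (1 + A_F)` converges to the extended determinant
(`IsHilbertSchmidt.tendsto_det_compress`).

For `|f| = |g| h²` this limit bounds the sums over `S ⊆ F` of `∏_{x ∈ S} |f x|` times the
probability of `S ⊆ X`. So the expansion of the functional over finite subsets is absolutely
convergent in `L¹`, which gives the almost sure convergence of the product, its integrability, and
integration term by term (`integrable_Phi_of_summable`).
-/

namespace DetMeasure

noncomputable section


/-! ### Finite matrices: determinant of the exponential, Hadamard's inequality, minors -/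

section Matrices

variable {n : Type*} [Fintype n] [DecidableEq n]

/-- A derivative form of `det (1 + s M) = 1 + s tr M + O(s²)`. -/
theorem hasDerivAt_det_of_eq_one {E : ℂ → Matrix n n ℂ} {M : Matrix n n ℂ}
    (hE : ∀ i j, HasDerivAt (fun s => E s i j) (M i j) 0) (h0 : E 0 = 1) :
    HasDerivAt (fun s => (E s).det) M.trace 0 := by
  simp only [Matrix.det_apply]
  have key : HasDerivAt (fun s => ∑ σ : Equiv.Perm n, Equiv.Perm.sign σ • ∏ i, E s (σ i) i)
      (∑ σ : Equiv.Perm n, Equiv.Perm.sign σ •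
        ∑ i, (∏ j ∈ Finset.univ.erase i, E 0 (σ j) j) • M (σ i) i) 0 := by
    refine HasDerivAt.fun_sum fun σ _ => ?_
    have h1 := HasDerivAt.fun_finsetProd (u := Finset.univ) (f := fun i s => E s (σ i) i)
      (x := (0 : ℂ)) (fun i _ => hE (σ i) i)
    have h2 := h1.const_mul (((Equiv.Perm.sign σ : ℤ) : ℂ))
    simpa [Units.smul_def] using h2
  convert key using 1
  rw [Finset.sum_eq_single 1]
  · simp only [Equiv.Perm.sign_one, one_smul, Equiv.Perm.one_apply, h0, Matrix.one_apply_eq,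
      Finset.prod_const_one, Matrix.trace, Matrix.diag_apply]
  · intro σ _ hσ
    refine smul_eq_zero_of_right _ (Finset.sum_eq_zero fun i _ => ?_)
    -- a nontrivial permutation moves at least two points, hence some point other than `i`
    obtain ⟨j, hj, hji⟩ : ∃ j, σ j ≠ j ∧ j ≠ i := by
      by_contra! hcon
      refine hσ (Equiv.ext fun j => ?_)
      by_contra hj
      have hji := hcon j hj
      have h3 : σ (σ j) ≠ σ j := fun h => hj (σ.injective h)
      exact hj ((hcon _ h3).trans hji.symm)
    rw [Finset.prod_eq_zero (Finset.mem_erase.2 ⟨hji, Finset.mem_univ j⟩), zero_smul]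
    rw [h0, Matrix.one_apply_ne hj]
  · simp

attribute [local instance] Matrix.linftyOpNormedRing Matrix.linftyOpNormedAlgebra in
open Filter Topology in
/-- `det (exp M) = det (exp (M / k)) ^ k`, and the right-hand side tends to `exp (tr M)` by the
derivative of the determinant at the identity. -/
theorem det_exp (M : Matrix n n ℂ) : (NormedSpace.exp M).det = Complex.exp M.trace := by
  have hE : ∀ i j, HasDerivAt (fun s : ℂ => NormedSpace.exp (s • M) i j) (M i j) 0 := by
    intro i j
    have h1 := hasDerivAt_exp_smul_const M (0 : ℂ)
    rw [zero_smul, NormedSpace.exp_zero, one_mul] at h1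
    exact (LinearMap.toContinuousLinearMap
      (Matrix.entryLinearMap ℂ ℂ i j)).hasFDerivAt.comp_hasDerivAt 0 h1
  have hd := hasDerivAt_det_of_eq_one hE (by simp)
  have ht : Tendsto (fun k : ℕ => ((k : ℂ) + 1)⁻¹) atTop (𝓝[≠] 0) := by
    refine tendsto_nhdsWithin_iff.2 ⟨?_, Eventually.of_forall fun k => ?_⟩
    · simpa using tendsto_one_div_add_atTop_nhds_zero_nat (𝕜 := ℂ)
    · exact inv_ne_zero (by exact_mod_cast k.succ_ne_zero)
  have h2 := hd.tendsto_slope_zero.comp ht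
  have h3 : Tendsto (fun k : ℕ => (k : ℂ) *
      ((NormedSpace.exp ((k : ℂ)⁻¹ • M)).det - 1)) atTop (𝓝 M.trace) := by
    rw [← tendsto_add_atTop_iff_nat 1]
    refine h2.congr fun k => ?_
    simp
  have h4 := Complex.tendsto_one_add_pow_exp_of_tendsto h3
  refine tendsto_nhds_unique (tendsto_const_nhds.congr' ?_) h4
  filter_upwards [eventually_ne_atTop 0] with k hk
  rw [add_sub_cancel, ← Matrix.det_pow, ← Matrix.exp_nsmul, ← Nat.cast_smul_eq_nsmul ℂ, smul_smul,
    mul_inv_cancel₀ (by exact_mod_cast hk), one_smul]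

open scoped ComplexOrder in
/-- Hadamard's inequality, for rows of norm at most one. -/
theorem norm_det_le_one_of_rows {M : Matrix n n ℂ} (hM : ∀ i, ∑ j, ‖M i j‖ ^ 2 ≤ 1) :
    ‖M.det‖ ≤ 1 := by
  have hpos := Matrix.posSemidef_self_mul_conjTranspose M
  have hH := hpos.isHermitian
  have htr : ∑ i, hH.eigenvalues i ≤ Fintype.card n := by
    have h1 : (M * M.conjTranspose).trace = ∑ i, (hH.eigenvalues i : ℂ) :=
      hH.trace_eq_sum_eigenvalues
    have h2 : (M * M.conjTranspose).trace = ((∑ i, ∑ j, ‖M i j‖ ^ 2 : ℝ) : ℂ) := by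
      simp [Matrix.trace, Matrix.mul_apply, Complex.mul_conj']
    rw [h2] at h1
    have h3 : ∑ i, ∑ j, ‖M i j‖ ^ 2 = ∑ i, hH.eigenvalues i := by exact_mod_cast h1
    rw [← h3]
    calc _ ≤ ∑ _i : n, (1 : ℝ) := Finset.sum_le_sum fun i _ => hM i
      _ = _ := by simp
  have hdet : ‖M.det‖ ^ 2 = ∏ i, hH.eigenvalues i := by
    have h1 : (M * M.conjTranspose).det = ∏ i, (hH.eigenvalues i : ℂ) :=
      hH.det_eq_prod_eigenvalues
    rw [Matrix.det_mul, Matrix.det_conjTranspose, Complex.star_def, Complex.mul_conj'] at h1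
    exact_mod_cast h1
  have hprod : ∏ i, hH.eigenvalues i ≤ 1 := by
    -- `λ ≤ exp (λ - 1)`, and the eigenvalues of `M Mᴴ` add up to at most their number
    calc ∏ i, hH.eigenvalues i ≤ ∏ i, Real.exp (hH.eigenvalues i - 1) :=
          Finset.prod_le_prod (fun i _ => hpos.eigenvalues_nonneg i)
            fun i _ => by linarith [Real.add_one_le_exp (hH.eigenvalues i - 1)]
      _ = Real.exp (∑ i, (hH.eigenvalues i - 1)) := (Real.exp_sum _ _).symm
      _ ≤ 1 := by
          rw [Real.exp_le_one_iff, Finset.sum_sub_distrib]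
          simpa using htr
  rw [← hdet] at hprod
  exact (sq_le_one_iff₀ (norm_nonneg _)).1 hprod

variable {E : Type*} [NormedAddCommGroup E] [InnerProductSpace ℂ E]

theorem norm_det_inner_le_one {u v : n → E} (hu : ∀ i, ‖u i‖ ≤ 1) (hv : ∀ i, ‖v i‖ ≤ 1) :
    ‖(Matrix.of fun i j => inner ℂ (u i) (v j)).det‖ ≤ 1 := by
  by_cases hli : LinearIndependent ℂ v
  · let W := Submodule.span ℂ (Set.range v)
    have hfin : FiniteDimensional ℂ W := FiniteDimensional.span_of_finite ℂ (Set.finite_range v)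
    have hcard : Module.finrank ℂ W = Fintype.card n := finrank_span_eq_card hli
    let b : OrthonormalBasis n ℂ W := (stdOrthonormalBasis ℂ W).reindex
      ((finCongr hcard).trans (Fintype.equivFin n).symm)
    have hb : Orthonormal ℂ (fun i => (b i : E)) :=
      b.orthonormal.comp_linearIsometry W.subtypeₗᵢ
    have hbessel : ∀ w : E, ‖w‖ ≤ 1 → ∑ i, ‖inner ℂ (b i : E) w‖ ^ 2 ≤ 1 := fun w hw =>
      (hb.sum_inner_products_le w).trans (pow_le_one₀ (norm_nonneg _) hw)
    have hfac : (Matrix.of fun i j => inner ℂ (u i) (v j)) =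
        (Matrix.of fun i k => inner ℂ (u i) (b k : E)) *
          (Matrix.of fun j k => inner ℂ (b k : E) (v j)).transpose := by
      ext i j
      have hvj : v j ∈ W := Submodule.subset_span ⟨j, rfl⟩
      have h1 : v j = ∑ k, inner ℂ (b k : E) (v j) • (b k : E) := by
        have := congrArg (Subtype.val) (b.sum_repr' ⟨v j, hvj⟩)
        simpa using this.symm
      simp only [Matrix.of_apply, Matrix.mul_apply, Matrix.transpose_apply]
      conv_lhs => rw [h1]
      rw [inner_sum]
      refine Finset.sum_congr rfl fun k _ => ?_
      rw [inner_smul_right, mul_comm]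
    rw [hfac, Matrix.det_mul, Matrix.det_transpose, norm_mul]
    refine mul_le_one₀ (norm_det_le_one_of_rows fun i => ?_) (norm_nonneg _)
      (norm_det_le_one_of_rows fun i => ?_)
    · simpa [norm_inner_symm] using hbessel (u i) (hu i)
    · simpa using hbessel (v i) (hv i)
  · obtain ⟨w, hw, i, hi⟩ := Fintype.not_linearIndependent_iff.1 hli
    have h0 : (Matrix.of fun i j => inner ℂ (u i) (v j)).det = 0 := by
      refine Matrix.exists_mulVec_eq_zero_iff.1 ⟨w, fun h => hi (congrFun h i), ?_⟩
      ext k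
      have h1 : inner ℂ (u k) (∑ j, w j • v j) = 0 := by rw [hw, inner_zero_right]
      simpa [inner_sum, inner_smul_right, Matrix.mulVec, dotProduct, mul_comm] using h1
    rw [h0]
    simp

/-- Hadamard's inequality for the matrix of inner products of two families of vectors. -/
theorem norm_det_inner_le (u v : n → E) :
    ‖(Matrix.of fun i j => inner ℂ (u i) (v j)).det‖ ≤ ∏ i, ‖u i‖ * ‖v i‖ := by
  have hscale : ∀ w : E, ‖(‖w‖ : ℂ)⁻¹ • w‖ ≤ 1 := fun w => by
    rw [norm_smul, norm_inv, Complex.norm_real, norm_norm]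
    exact inv_mul_le_one_of_le₀ le_rfl (norm_nonneg _)
  have hw : ∀ w : E, w = (‖w‖ : ℂ) • ((‖w‖ : ℂ)⁻¹ • w) := fun w => by
    by_cases h : w = 0
    · simp [h]
    · rw [smul_smul, mul_inv_cancel₀ (by simpa using h), one_smul]
  have h1 : (Matrix.of fun i j => inner ℂ (u i) (v j)) =
      Matrix.of fun i j => (‖u i‖ : ℂ) * Matrix.of (fun i j => (‖v j‖ : ℂ) *
        Matrix.of (fun i j => inner ℂ ((‖u i‖ : ℂ)⁻¹ • u i) ((‖v j‖ : ℂ)⁻¹ • v j)) i j) i j := by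
    ext i j
    conv_lhs => rw [Matrix.of_apply, hw (u i), hw (v j)]
    rw [inner_smul_left, inner_smul_right, Complex.conj_ofReal]
    rfl
  rw [h1, Matrix.det_mul_column, Matrix.det_mul_row, norm_mul, norm_mul, norm_prod, norm_prod,
    Finset.prod_mul_distrib]
  simp only [Complex.norm_real, norm_norm]
  rw [← mul_assoc]
  exact mul_le_of_le_one_right (by positivity)
    (norm_det_inner_le_one (fun i => hscale (u i)) fun i => hscale (v i))

theorem det_one_add_eq_sum_minors {R : Type*} [CommRing R] (M : Matrix n n R) :
    (1 + M).det = ∑ s : Finset n, (M.submatrix (Subtype.val : s → n) Subtype.val).det := by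
  have h := (Matrix.detRowAlternating : (n → R) [⋀^n]→ₗ[R] R).map_add_univ M.row
    (Matrix.row 1)
  rw [add_comm]
  refine h.trans (Finset.sum_congr rfl fun s _ => ?_)
  exact Matrix.det_piecewise_one_eq_submatrix_det M s

theorem sum_powerset_minors {ι R : Type*} [DecidableEq ι] [CommRing R] (k : ι → ι → R)
    (F : Finset ι) :
    ∑ S ∈ F.powerset, (Matrix.of fun x y : S => k x y).det =
      (1 + Matrix.of fun x y : F => k x y).det := by
  rw [det_one_add_eq_sum_minors]
  symm
  refine Finset.sum_bij (fun s _ => s.map (Function.Embedding.subtype _)) ?_ ?_ ?_ ?_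
  · intro s _
    rw [Finset.mem_powerset]
    intro x hx
    obtain ⟨y, -, rfl⟩ := Finset.mem_map.1 hx
    exact y.2
  · intro s _ t _ h
    exact Finset.map_injective _ h
  · intro S hS
    refine ⟨S.subtype (fun x => x ∈ F), Finset.mem_univ _, ?_⟩
    exact Finset.subtype_map_of_mem (Finset.mem_powerset.1 hS)
  · intro s _
    let φ : s ≃ (s.map (Function.Embedding.subtype fun x => x ∈ F) : Finset ι) :=
      Equiv.ofBijective (fun x => ⟨x.1.1, Finset.mem_map.2 ⟨x.1, x.2, rfl⟩⟩)
        ⟨fun x y h => Subtype.ext (Subtype.ext (by simpa using h)), fun y => by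
          obtain ⟨x, hx, hxy⟩ := Finset.mem_map.1 y.2
          exact ⟨⟨x, hx⟩, Subtype.ext hxy⟩⟩
    exact Matrix.det_submatrix_equiv_self φ (Matrix.of fun x y => k x y)

end Matrices


/-! ### Coordinates and coordinate projections in `ℓ²` -/

section Operators

open ContinuousLinearMap Filter Topology

variable {ι : Type}

theorem hasSum_sq_coord (v : L2 ι) : HasSum (fun x => ‖v x‖ ^ 2) (‖v‖ ^ 2) := by
  simpa using lp.hasSum_norm (p := 2) (by norm_num) v

open scoped Classical in
theorem proj_apply (Y : Set ι) (v : L2 ι) (x : ι) :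
    proj Y v x = if x ∈ Y then v x else 0 := by
  simp [proj]

theorem adjoint_proj (Y : Set ι) : adjoint (proj Y : L2 ι →L[ℂ] L2 ι) = proj Y := by
  classical
  refine ((eq_adjoint_iff _ _).2 fun v w => ?_).symm
  rw [lp.inner_eq_tsum, lp.inner_eq_tsum]
  refine tsum_congr fun x => ?_
  rw [proj_apply, proj_apply]
  split_ifs <;> simp

theorem norm_proj_apply_le (Y : Set ι) (v : L2 ι) : ‖proj Y v‖ ≤ ‖v‖ := by
  classical
  refine le_of_sq_le_sq ?_ (norm_nonneg _)
  refine hasSum_le (fun x => ?_) (hasSum_sq_coord (proj Y v)) (hasSum_sq_coord v)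
  rw [proj_apply]
  split_ifs
  · exact le_rfl
  · simp

theorem norm_proj_le (Y : Set ι) : ‖(proj Y : L2 ι →L[ℂ] L2 ι)‖ ≤ 1 :=
  opNorm_le_bound _ zero_le_one fun v => by simpa using norm_proj_apply_le Y v

theorem norm_block_le (Y : Set ι) (A : L2 ι →L[ℂ] L2 ι) : ‖block Y Y A‖ ≤ ‖A‖ := by
  calc ‖proj Y * A * proj Y‖
      ≤ ‖(proj Y : L2 ι →L[ℂ] L2 ι)‖ * ‖A‖ * ‖(proj Y : L2 ι →L[ℂ] L2 ι)‖ :=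
        (norm_mul_le _ _).trans (mul_le_mul_of_nonneg_right (norm_mul_le _ _) (norm_nonneg _))
    _ ≤ 1 * ‖A‖ * 1 := by
        gcongr <;> exact norm_proj_le Y
    _ = ‖A‖ := by ring

theorem adjoint_block (Y : Set ι) (A : L2 ι →L[ℂ] L2 ι) :
    adjoint (block Y Y A) = block Y Y (adjoint A) := by
  rw [block, block, ← star_eq_adjoint, ← star_eq_adjoint, star_mul, star_mul, star_eq_adjoint,
    star_eq_adjoint, adjoint_proj, mul_assoc]

variable [DecidableEq ι]

theorem inner_e_left (x : ι) (v : L2 ι) : inner ℂ (e x) v = v x := by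
  simp [e, lp.inner_single_left]

theorem kernel_eq_inner (A : L2 ι →L[ℂ] L2 ι) (x y : ι) :
    kernel A x y = inner ℂ (e x) (A (e y)) := (inner_e_left _ _).symm

theorem kernel_mul (A B : L2 ι →L[ℂ] L2 ι) (x y : ι) :
    kernel (A * B) x y = inner ℂ (adjoint A (e x)) (B (e y)) := by
  rw [kernel_eq_inner, adjoint_inner_left]
  rfl

theorem kernel_adjoint (A : L2 ι →L[ℂ] L2 ι) (x y : ι) :
    kernel (adjoint A) x y = star (kernel A y x) := by
  rw [kernel_eq_inner, kernel_eq_inner, adjoint_inner_right, Complex.star_def, inner_conj_symm]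

/-! ### Hilbert–Schmidt and trace class operators -/

theorem IsHilbertSchmidt.adjoint {A : L2 ι →L[ℂ] L2 ι} (hA : IsHilbertSchmidt A) :
    IsHilbertSchmidt (adjoint A) := by
  have h1 : Summable fun p : ι × ι => ‖kernel A p.2 p.1‖ ^ 2 := by
    rw [summable_prod_of_nonneg fun p => by positivity]
    refine ⟨fun y => (hasSum_sq_coord (A (e y))).summable, ?_⟩
    refine hA.congr fun y => ?_
    exact (hasSum_sq_coord (A (e y))).tsum_eq.symm
  have h2 : Summable fun p : ι × ι => ‖kernel A p.1 p.2‖ ^ 2 :=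
    (Equiv.prodComm ι ι).summable_iff.1 h1
  rw [summable_prod_of_nonneg fun p => by positivity] at h2
  refine h2.2.congr fun x => ?_
  rw [← (hasSum_sq_coord (ContinuousLinearMap.adjoint A (e x))).tsum_eq]
  refine tsum_congr fun y => ?_
  change _ = ‖kernel (ContinuousLinearMap.adjoint A) y x‖ ^ 2
  rw [kernel_adjoint, norm_star]

theorem IsHilbertSchmidt.mul_left {A : L2 ι →L[ℂ] L2 ι} (hA : IsHilbertSchmidt A)
    (C : L2 ι →L[ℂ] L2 ι) : IsHilbertSchmidt (C * A) := by
  refine (Summable.mul_left (‖C‖ ^ 2) hA).of_nonneg_of_le (fun x => by positivity) fun x => ?_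
  rw [← mul_pow]
  gcongr
  exact C.le_opNorm _

theorem IsHilbertSchmidt.mul_right {A : L2 ι →L[ℂ] L2 ι} (hA : IsHilbertSchmidt A)
    (C : L2 ι →L[ℂ] L2 ι) : IsHilbertSchmidt (A * C) := by
  have h := (hA.adjoint.mul_left (ContinuousLinearMap.adjoint C)).adjoint
  rwa [← star_eq_adjoint, ← star_eq_adjoint, ← star_eq_adjoint, star_mul, star_star,
    star_star] at h

theorem IsHilbertSchmidt.add {A B : L2 ι →L[ℂ] L2 ι} (hA : IsHilbertSchmidt A)
    (hB : IsHilbertSchmidt B) : IsHilbertSchmidt (A + B) := by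
  refine (Summable.mul_left 2 (Summable.add hA hB)).of_nonneg_of_le (fun x => by positivity)
    fun x => ?_
  calc ‖(A + B) (e x)‖ ^ 2 ≤ (‖A (e x)‖ + ‖B (e x)‖) ^ 2 := by
        gcongr
        exact norm_add_le _ _
    _ ≤ 2 * (‖A (e x)‖ ^ 2 + ‖B (e x)‖ ^ 2) := by
        nlinarith [sq_nonneg (‖A (e x)‖ - ‖B (e x)‖)]

/-- The operator norm is bounded by the Hilbert–Schmidt norm of the adjoint. -/
theorem norm_sq_le_tsum_adjoint {A : L2 ι →L[ℂ] L2 ι} (hA : IsHilbertSchmidt (adjoint A)) :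
    ‖A‖ ^ 2 ≤ ∑' x, ‖adjoint A (e x)‖ ^ 2 := by
  have h0 : 0 ≤ ∑' x, ‖adjoint A (e x)‖ ^ 2 := tsum_nonneg fun x => by positivity
  refine (Real.le_sqrt (norm_nonneg _) h0).1 (A.opNorm_le_bound (Real.sqrt_nonneg _) fun v => ?_)
  refine le_of_sq_le_sq ?_ (by positivity)
  rw [mul_pow, Real.sq_sqrt h0]
  refine hasSum_le (fun x => ?_) (hasSum_sq_coord (A v)) ((Summable.hasSum hA).mul_right (‖v‖ ^ 2))
  rw [← mul_pow, ← inner_e_left, ← adjoint_inner_left]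
  gcongr
  exact norm_inner_le_norm _ _

/-- Douglas' factorization: an operator dominated by `D` factors through `D`. -/
theorem exists_eq_mul_of_norm_le {E : Type*} [NormedAddCommGroup E] [InnerProductSpace ℂ E]
    [CompleteSpace E] {T D : E →L[ℂ] E} (h : ∀ v, ‖T v‖ ≤ ‖D v‖) :
    ∃ U : E →L[ℂ] E, T = U * D := by
  let W : Submodule ℂ E := (LinearMap.range D.toLinearMap).topologicalClosure
  have : CompleteSpace W := (Submodule.isClosed_topologicalClosure _).completeSpace_coe
  have hW : ∀ v, D v ∈ W := fun v => Submodule.le_topologicalClosure _ ⟨v, rfl⟩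
  let i : E →ₗ[ℂ] W := D.toLinearMap.codRestrict W hW
  have hi : DenseRange i := by
    refine Subtype.dense_iff.2 fun w hw => ?_
    have h1 : ((↑) '' Set.range i : Set E) = LinearMap.range D.toLinearMap := by
      ext z
      simp [i]
    exact h1 ▸ hw
  refine ⟨(T.toLinearMap.extendOfNorm i) ∘L W.orthogonalProjectionOnto, ?_⟩
  ext v
  have h2 : W.orthogonalProjectionOnto (D v) = i v :=
    Submodule.orthogonalProjectionOnto_mem_subspace_eq_self (⟨D v, hW v⟩ : W)
  have h3 := LinearMap.extendOfNorm_eq (f := T.toLinearMap) hi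
    ⟨1, fun x => by simpa [i] using h x⟩ v
  change T v = T.toLinearMap.extendOfNorm i (W.orthogonalProjectionOnto (D v))
  rw [h2, h3]
  rfl

/-- A substitute for the polar decomposition: `A = V |A|^{1/2} |A|^{1/2}` with `V` bounded. -/
theorem exists_eq_mul_sqrt_abs {E : Type} [NormedAddCommGroup E] [InnerProductSpace ℂ E]
    [CompleteSpace E] (A : E →L[ℂ] E) :
    ∃ V S : E →L[ℂ] E, adjoint S = S ∧ S * S = absOp A ∧ A = V * S * S := by
  have hSS : CFC.sqrt (absOp A) * CFC.sqrt (absOp A) = absOp A :=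
    CFC.sqrt_mul_sqrt_self _ (CFC.abs_nonneg A)
  have hnorm : ∀ v, ‖A v‖ = ‖absOp A v‖ := fun v => by
    have h1 : adjoint (absOp A) * absOp A = adjoint A * A := by
      have habs : adjoint (absOp A) = absOp A :=
        (IsSelfAdjoint.of_nonneg (CFC.abs_nonneg A) : IsSelfAdjoint (absOp A))
      rw [habs]
      exact CFC.abs_mul_abs A
    have h2 : ∀ T : E →L[ℂ] E, ((‖T v‖ ^ 2 : ℝ) : ℂ) = inner ℂ ((adjoint T * T) v) v := by
      intro T
      change _ = inner ℂ (adjoint T (T v)) v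
      rw [adjoint_inner_left, inner_self_eq_norm_sq_to_K]
      norm_cast
    have h3 : ‖A v‖ ^ 2 = ‖absOp A v‖ ^ 2 := by
      apply Complex.ofReal_injective
      rw [h2, h2, h1]
    exact (sq_eq_sq₀ (norm_nonneg _) (norm_nonneg _)).1 h3
  obtain ⟨V, hV⟩ := exists_eq_mul_of_norm_le fun v => (hnorm v).le
  exact ⟨V, CFC.sqrt (absOp A), IsSelfAdjoint.of_nonneg (CFC.sqrt_nonneg (absOp A)), hSS,
    by rw [mul_assoc, hSS]; exact hV⟩

/-- A trace class operator is a product of two Hilbert–Schmidt operators. -/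
theorem IsTraceClass.exists_eq_mul {T : L2 ι →L[ℂ] L2 ι} (hT : IsTraceClass T) :
    ∃ U S : L2 ι →L[ℂ] L2 ι, IsHilbertSchmidt U ∧ IsHilbertSchmidt S ∧ T = U * S := by
  obtain ⟨V, S, hSsa, hSS, hV⟩ := exists_eq_mul_sqrt_abs T
  have hS : IsHilbertSchmidt S := by
    refine hT.congr fun x => ?_
    rw [← hSS, kernel_mul, hSsa, inner_self_eq_norm_sq_to_K]
    norm_cast
  exact ⟨V * S, S, hS.mul_left V, hS, hV⟩

theorem IsTraceClass.isHilbertSchmidt {T : L2 ι →L[ℂ] L2 ι} (hT : IsTraceClass T) :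
    IsHilbertSchmidt T := by
  obtain ⟨U, S, -, hS, rfl⟩ := hT.exists_eq_mul
  exact hS.mul_left U

theorem IsHilbertSchmidt.summable_norm_mul_norm {A B : L2 ι →L[ℂ] L2 ι}
    (hA : IsHilbertSchmidt A) (hB : IsHilbertSchmidt B) :
    Summable fun x => ‖A (e x)‖ * ‖B (e x)‖ := by
  refine (Summable.add hA hB).of_nonneg_of_le (fun x => by positivity) fun x => ?_
  nlinarith [sq_nonneg (‖A (e x)‖ - ‖B (e x)‖), sq_nonneg ‖A (e x)‖, sq_nonneg ‖B (e x)‖]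

theorem IsTraceClass.summable_diag {T : L2 ι →L[ℂ] L2 ι} (hT : IsTraceClass T) :
    Summable fun x => ‖kernel T x x‖ := by
  obtain ⟨U, S, hU, hS, rfl⟩ := hT.exists_eq_mul
  refine (hU.adjoint.summable_norm_mul_norm hS).of_nonneg_of_le (fun x => norm_nonneg _)
    fun x => ?_
  rw [kernel_mul]
  exact norm_inner_le_norm _ _

/-! ### Truncation to finite sets of coordinates -/

open scoped Classical in
theorem proj_e (Y : Set ι) (y : ι) : proj Y (e y) = if y ∈ Y then e y else 0 := by
  ext x
  rw [proj_apply]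
  by_cases hxy : x = y
  · subst hxy
    split_ifs <;> rfl
  · have h : (e y : L2 ι) x = 0 := by simp [e, hxy]
    split_ifs <;> simp [h]

open scoped Classical in
theorem kernel_block (Y Z : Set ι) (A : L2 ι →L[ℂ] L2 ι) (x y : ι) :
    kernel (block Y Z A) x y = if x ∈ Y ∧ y ∈ Z then kernel A x y else 0 := by
  change proj Y (A (proj Z (e y))) x = _
  rw [proj_apply, proj_e]
  by_cases hx : x ∈ Y <;> by_cases hy : y ∈ Z <;> simp [hx, hy, kernel]

theorem norm_block_e_le (Y : Set ι) (A : L2 ι →L[ℂ] L2 ι) (y : ι) :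
    ‖block Y Y A (e y)‖ ≤ ‖A (e y)‖ := by
  classical
  change ‖proj Y (A (proj Y (e y)))‖ ≤ _
  rw [proj_e]
  split_ifs
  · exact norm_proj_apply_le Y _
  · simp

theorem tendsto_proj_apply (v : L2 ι) :
    Tendsto (fun F : Finset ι => proj (F : Set ι) v) atTop (𝓝 v) := by
  classical
  have h : HasSum (fun x => lp.single 2 x (v x)) v := lp.hasSum_single (by norm_num) v
  refine h.congr fun F => ?_
  ext x
  have hsum : (∑ y ∈ F, (lp.single 2 y (v y) : L2 ι)) x =
      ∑ y ∈ F, (lp.single 2 y (v y) : L2 ι) x := by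
    simp_rw [← inner_e_left x]
    rw [inner_sum]
  rw [proj_apply, hsum]
  by_cases hx : x ∈ F
  · rw [Finset.sum_eq_single_of_mem x hx fun y _ hy => by simp [hy.symm]]
    simp [hx]
  · rw [Finset.sum_eq_zero fun y hy => by
      have : x ≠ y := fun h => hx (h ▸ hy)
      simp [this]]
    simp [hx]

theorem tendsto_block_e (A : L2 ι →L[ℂ] L2 ι) (y : ι) :
    Tendsto (fun F : Finset ι => block (F : Set ι) F A (e y)) atTop (𝓝 (A (e y))) := by
  refine (tendsto_proj_apply (A (e y))).congr' ?_
  filter_upwards [eventually_ge_atTop {y}] with F hF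
  have hy : y ∈ (F : Set ι) := Finset.singleton_subset_iff.1 hF
  change _ = proj (F : Set ι) (A (proj (F : Set ι) (e y)))
  rw [proj_e, if_pos hy]

/-- The finite truncations of a Hilbert–Schmidt operator converge to it in operator norm. -/
theorem IsHilbertSchmidt.tendsto_block {A : L2 ι →L[ℂ] L2 ι} (hA : IsHilbertSchmidt A) :
    Tendsto (fun F : Finset ι => block (F : Set ι) F A) atTop (𝓝 A) := by
  set A' := ContinuousLinearMap.adjoint A with hA'
  have hHS : IsHilbertSchmidt A' := hA.adjoint
  have hbound : ∀ (F : Finset ι) x, ‖block (F : Set ι) F A' (e x) - A' (e x)‖ ^ 2 ≤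
      4 * ‖A' (e x)‖ ^ 2 := fun F x => by
    calc _ ≤ (‖A' (e x)‖ + ‖A' (e x)‖) ^ 2 := by
          gcongr
          exact (norm_sub_le _ _).trans (by gcongr; exact norm_block_e_le _ _ _)
      _ = _ := by ring
  have hlim : Tendsto (fun F : Finset ι => ∑' x, ‖block (F : Set ι) F A' (e x) - A' (e x)‖ ^ 2)
      atTop (𝓝 (∑' _ : ι, 0)) := by
    refine tendsto_tsum_of_dominated_convergence (Summable.mul_left 4 hHS) (fun x => ?_)
      (Eventually.of_forall fun F x => ?_)
    · simpa using ((tendsto_block_e A' x).sub_const (A' (e x))).norm.pow 2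
    · rw [Real.norm_of_nonneg (by positivity)]
      exact hbound F x
  rw [tsum_zero] at hlim
  rw [tendsto_iff_norm_sub_tendsto_zero]
  have hle : ∀ F : Finset ι, ‖block (F : Set ι) F A - A‖ ≤
      √(∑' x, ‖block (F : Set ι) F A' (e x) - A' (e x)‖ ^ 2) := fun F => by
    have hadj : ContinuousLinearMap.adjoint (block (F : Set ι) F A - A) =
        block (F : Set ι) F A' - A' := by
      rw [map_sub, adjoint_block]
    refine Real.le_sqrt_of_sq_le ?_
    have h := norm_sq_le_tsum_adjoint (A := block (F : Set ι) F A - A) (by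
      rw [hadj]
      exact (Summable.mul_left 4 hHS).of_nonneg_of_le (fun x => by positivity) (hbound F))
    rwa [hadj] at h
  refine squeeze_zero (fun F => norm_nonneg _) hle ?_
  simpa using hlim.sqrt

end Operators


/-! ### The regularised determinant as a limit of finite determinants -/

section Determinants

open ContinuousLinearMap Filter Topology

variable {ι : Type}

/-- The operator `(1 + A) e^{-A} - 1`, whose Fredholm determinant is the regularised determinant
of `1 + A`. -/
def regPart (A : L2 ι →L[ℂ] L2 ι) : L2 ι →L[ℂ] L2 ι := (1 + A) * NormedSpace.exp (-A) - 1

theorem continuous_regPart : Continuous (regPart : (L2 ι →L[ℂ] L2 ι) → _) := by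
  unfold regPart
  let _ : NormedAlgebra ℚ (L2 ι →L[ℂ] L2 ι) := NormedAlgebra.restrictScalars ℚ ℂ _
  have h : Continuous fun A : L2 ι →L[ℂ] L2 ι => NormedSpace.exp (-A) :=
    NormedSpace.exp_continuous.comp continuous_neg
  fun_prop

/-- The entire function `(1 + z) e^{-z} - 1` has a double zero at the origin, so `regPart A` is
`A Ψ A`. When `A` is Hilbert–Schmidt this exhibits it as a product of two Hilbert–Schmidt
operators. -/
theorem exists_regPart_eq (A : L2 ι →L[ℂ] L2 ι) :
    ∃ Ψ : L2 ι →L[ℂ] L2 ι, ‖Ψ‖ ≤ Real.exp ‖A‖ ∧ regPart A = A * Ψ * A := by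
  set Z := -A with hZ
  let c : ℕ → ℂ := fun n => ((n + 2).factorial : ℂ)⁻¹ - ((n + 1).factorial : ℂ)⁻¹
  have hpow : ∀ n, ‖Z ^ n‖ ≤ ‖A‖ ^ n := fun n => by
    cases n with
    | zero =>
      rw [pow_zero, pow_zero]
      exact norm_id_le
    | succ n => simpa [hZ] using norm_pow_le' Z n.succ_pos
  have hc : ∀ n, ‖c n‖ ≤ (n.factorial : ℝ)⁻¹ := fun n => by
    have h1 : c n = ((((n + 2).factorial : ℝ)⁻¹ - ((n + 1).factorial : ℝ)⁻¹ : ℝ) : ℂ) := by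
      simp [c]
    have h2 : ((n + 2).factorial : ℝ)⁻¹ ≤ ((n + 1).factorial : ℝ)⁻¹ := by
      gcongr
      omega
    have h3 : ((n + 1).factorial : ℝ)⁻¹ ≤ (n.factorial : ℝ)⁻¹ := by
      gcongr
      omega
    have h4 : (0 : ℝ) ≤ ((n + 2).factorial : ℝ)⁻¹ := by positivity
    rw [h1, Complex.norm_real, Real.norm_eq_abs, abs_le]
    constructor <;> linarith
  have hterm : ∀ n, ‖c n • Z ^ n‖ ≤ ‖A‖ ^ n / n.factorial := fun n => by
    rw [norm_smul, div_eq_inv_mul]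
    exact mul_le_mul (hc n) (hpow n) (norm_nonneg _) (by positivity)
  have hexp : HasSum (fun n => ‖A‖ ^ n / n.factorial) (Real.exp ‖A‖) := by
    rw [Real.exp_eq_exp_ℝ]
    exact NormedSpace.expSeries_div_hasSum_exp ‖A‖
  have hΨ : Summable fun n => c n • Z ^ n := Summable.of_norm_bounded hexp.summable hterm
  refine ⟨∑' n, c n • Z ^ n, tsum_of_norm_bounded hexp hterm, ?_⟩
  have h0 : HasSum (fun n => ((n.factorial : ℂ))⁻¹ • Z ^ n) (NormedSpace.exp Z) :=
    NormedSpace.exp_series_hasSum_exp' (𝕂 := ℂ) Z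
  -- with `Z = -A`, expand `(1 - Z) e^Z - 1 = (e^Z - 1 - Z) - Z (e^Z - 1)` in powers of `Z`
  have h1 := (hasSum_nat_add_iff' 2).2 h0
  have h2 := ((hasSum_nat_add_iff' 1).2 h0).mul_left Z
  have h3 := (hΨ.hasSum.mul_left Z).mul_right Z
  have h4 : (fun n => Z * (c n • Z ^ n) * Z) = fun n =>
      ((n + 2).factorial : ℂ)⁻¹ • Z ^ (n + 2) - Z * (((n + 1).factorial : ℂ)⁻¹ • Z ^ (n + 1)) := by
    funext n
    rw [mul_smul_comm, smul_mul_assoc, mul_smul_comm, ← pow_succ', ← pow_succ, ← pow_succ',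
      ← sub_smul]
  rw [h4] at h3
  have h5 := (h1.sub h2).unique h3
  have hA : A = -Z := by rw [hZ, neg_neg]
  have h6 : A * (∑' n, c n • Z ^ n) * A = Z * (∑' n, c n • Z ^ n) * Z := by
    simp only [hA, neg_mul, mul_neg, neg_neg]
  have h7 : regPart A = (1 + -Z) * NormedSpace.exp Z - 1 := by rw [regPart, ← hA]
  rw [h6, h7, ← h5]
  simp only [Finset.sum_range_succ, Finset.sum_range_zero]
  simp only [Nat.factorial_zero, Nat.factorial_one, Nat.cast_one, inv_one, one_smul, pow_zero,
    pow_one]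
  noncomm_ring

variable [DecidableEq ι]

/-- Each principal minor of `regPart A` is bounded by a product over its index set, by Hadamard's
inequality for the vectors `A* e_x` and `Ψ A e_x`. -/
theorem norm_minor_regPart_le (A : L2 ι →L[ℂ] L2 ι) (S : Finset ι) :
    ‖(Matrix.of fun x y : S => kernel (regPart A) x y).det‖ ≤
      ∏ x ∈ S, Real.exp ‖A‖ * (‖adjoint A (e x)‖ * ‖A (e x)‖) := by
  obtain ⟨Ψ, hΨ, hA⟩ := exists_regPart_eq A
  have h1 : (Matrix.of fun x y : S => kernel (regPart A) x y) =
      Matrix.of fun x y : S => inner ℂ (adjoint A (e (x : ι))) (Ψ (A (e (y : ι)))) := by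
    ext x y
    rw [Matrix.of_apply, hA, mul_assoc, kernel_mul]
    rfl
  rw [h1]
  refine (norm_det_inner_le _ _).trans ?_
  rw [← Finset.prod_coe_sort S]
  refine Finset.prod_le_prod (fun x _ => by positivity) fun x _ => ?_
  calc _ ≤ ‖adjoint A (e (x : ι))‖ * (Real.exp ‖A‖ * ‖A (e (x : ι))‖) := by
        gcongr
        exact Ψ.le_of_opNorm_le hΨ _
    _ = _ := by ring

theorem continuous_kernel (x y : ι) : Continuous fun A : L2 ι →L[ℂ] L2 ι => kernel A x y := by
  simp only [kernel_eq_inner]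
  fun_prop

/-- Dominated convergence of the Fredholm series: passing to a truncation of `A` does not increase
the bound of `norm_minor_regPart_le`. -/
theorem IsHilbertSchmidt.tendsto_fredholmDet_regPart {A : L2 ι →L[ℂ] L2 ι}
    (hA : IsHilbertSchmidt A) :
    Tendsto (fun F : Finset ι => fredholmDet (regPart (block (F : Set ι) F A))) atTop
      (𝓝 (fredholmDet (regPart A))) := by
  refine tendsto_tsum_of_dominated_convergence
    (bound := fun S => ∏ x ∈ S, Real.exp ‖A‖ *
      (‖ContinuousLinearMap.adjoint A (e x)‖ * ‖A (e x)‖)) ?_ (fun S => ?_) ?_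
  · exact summable_finsetProd_of_summable_nonneg (fun x => by positivity)
      ((hA.adjoint.summable_norm_mul_norm hA).mul_left _)
  · have hcont : Continuous fun X : L2 ι →L[ℂ] L2 ι =>
        (Matrix.of fun x y : S => kernel (regPart X) x y).det := by
      refine Continuous.matrix_det (continuous_matrix fun x y => ?_)
      exact (continuous_kernel _ _).comp continuous_regPart
    exact (hcont.tendsto A).comp hA.tendsto_block
  · refine Eventually.of_forall fun F S => (norm_minor_regPart_le _ S).trans ?_
    refine Finset.prod_le_prod (fun x _ => by positivity) fun x _ => ?_
    rw [adjoint_block]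
    gcongr
    · exact norm_block_le _ _
    · exact norm_block_e_le _ _ _
    · exact norm_block_e_le _ _ _

/-- The matrix of an operator with respect to the basis vectors indexed by a finite set. -/
def compress (F : Finset ι) : (L2 ι →L[ℂ] L2 ι) →ₗ[ℂ] Matrix F F ℂ where
  toFun X := Matrix.of fun x y : F => kernel X x y
  map_add' _ _ := rfl
  map_smul' _ _ := rfl

theorem compress_apply (F : Finset ι) (X : L2 ι →L[ℂ] L2 ι) :
    compress F X = Matrix.of fun x y : F => kernel X x y := rfl

theorem compress_one (F : Finset ι) : compress F 1 = 1 := by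
  ext x y
  change (e (y : ι) : L2 ι) (x : ι) = _
  by_cases h : x = y
  · subst h
    simp [e]
  · have h' : (x : ι) ≠ y := fun h'' => h (Subtype.ext h'')
    rw [Matrix.one_apply_ne h]
    simp [e, h']

/-- Compression is multiplicative when the right factor is a truncated operator. -/
theorem compress_mul_block (F : Finset ι) (X A : L2 ι →L[ℂ] L2 ι) :
    compress F (X * block (F : Set ι) F A) = compress F X * compress F A := by
  classical
  ext x y
  have h1 : HasSum
      (fun z => inner ℂ (adjoint X (e (x : ι)) z) (block (F : Set ι) F A (e (y : ι)) z))
      (kernel (X * block (F : Set ι) F A) x y) := by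
    rw [kernel_mul]
    exact lp.hasSum_inner _ _
  have h2 : ∀ z, inner ℂ (adjoint X (e (x : ι)) z) (block (F : Set ι) F A (e (y : ι)) z) =
      kernel X x z * kernel (block (F : Set ι) F A) z y := fun z => by
    have h3 : adjoint X (e (x : ι)) z = star (kernel X x z) := kernel_adjoint X z x
    rw [h3]
    simp [kernel, mul_comm]
  simp only [h2] at h1
  have h4 := h1.unique (hasSum_sum_of_ne_finset_zero (s := F) fun z hz => by
    rw [kernel_block, if_neg (fun h => hz h.1), mul_zero])
  rw [compress_apply, Matrix.of_apply, h4, Matrix.mul_apply, ← Finset.sum_coe_sort F]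
  refine Finset.sum_congr rfl fun z _ => ?_
  rw [kernel_block, if_pos ⟨z.2, y.2⟩]
  rfl

attribute [local instance] Matrix.linftyOpNormedRing Matrix.linftyOpNormedAlgebra in
theorem compress_exp_neg_block (F : Finset ι) (A : L2 ι →L[ℂ] L2 ι) :
    compress F (NormedSpace.exp (-block (F : Set ι) F A)) =
      NormedSpace.exp (-compress F A) := by
  have hpow : ∀ n : ℕ, compress F ((-block (F : Set ι) F A) ^ n) = (-compress F A) ^ n := by
    intro n
    induction n with
    | zero => simpa using compress_one F
    | succ n ih => rw [pow_succ, pow_succ, mul_neg, map_neg, compress_mul_block, ih, mul_neg]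
  have h1 : HasSum (fun n : ℕ => ((n.factorial : ℂ))⁻¹ • (-block (F : Set ι) F A) ^ n)
      (NormedSpace.exp (-block (F : Set ι) F A)) :=
    NormedSpace.exp_series_hasSum_exp' (𝕂 := ℂ) _
  have h2 : HasSum (fun n : ℕ => ((n.factorial : ℂ))⁻¹ • (-compress F A) ^ n)
      (NormedSpace.exp (-compress F A)) :=
    NormedSpace.exp_series_hasSum_exp' (𝕂 := ℂ) _
  have hcont : Continuous (compress F : (L2 ι →L[ℂ] L2 ι) → Matrix F F ℂ) :=
    continuous_matrix fun x y => continuous_kernel _ _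
  have h3 := h1.map (compress F) hcont
  refine h3.unique ?_
  convert h2 using 2 with n
  rw [Function.comp_apply, map_smul, hpow]

/-- For a truncated operator the regularised determinant is the one of a finite matrix. -/
theorem fredholmDet_regPart_block (F : Finset ι) (A : L2 ι →L[ℂ] L2 ι) :
    fredholmDet (regPart (block (F : Set ι) F A)) =
      (1 + compress F A).det * Complex.exp (-∑ x ∈ F, kernel A x x) := by
  classical
  obtain ⟨Ψ, -, hΨ⟩ := exists_regPart_eq (block (F : Set ι) F A)
  have hsupp : ∀ x y, x ∉ F → kernel (regPart (block (F : Set ι) F A)) x y = 0 := by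
    intro x y hx
    have h1 : adjoint (block (F : Set ι) F A) (e x) = 0 := by
      rw [adjoint_block]
      change proj (F : Set ι) (adjoint A (proj (F : Set ι) (e x))) = 0
      rw [proj_e, if_neg (by simpa using hx), map_zero, map_zero]
    rw [hΨ, mul_assoc, kernel_mul, h1, inner_zero_left]
  have hcomm : (1 + block (F : Set ι) F A) * NormedSpace.exp (-block (F : Set ι) F A) =
      NormedSpace.exp (-block (F : Set ι) F A) +
        NormedSpace.exp (-block (F : Set ι) F A) * block (F : Set ι) F A := by
    have h : Commute (block (F : Set ι) F A) (NormedSpace.exp (-block (F : Set ι) F A)) :=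
      (Commute.refl _).neg_right.exp_right
    rw [add_mul, one_mul, h.eq]
  have hreg : 1 + compress F (regPart (block (F : Set ι) F A)) =
      NormedSpace.exp (-compress F A) * (1 + compress F A) := by
    rw [regPart, map_sub, compress_one, add_sub_cancel, hcomm, map_add, compress_mul_block,
      compress_exp_neg_block, mul_add, mul_one]
  rw [fredholmDet, tsum_eq_sum (s := F.powerset), sum_powerset_minors, ← compress_apply, hreg,
    Matrix.det_mul, det_exp, mul_comm, Matrix.trace_neg]
  · congr 3
    exact Finset.sum_coe_sort F fun x => kernel A x x
  · intro S hS
    rw [Finset.mem_powerset, Finset.not_subset] at hS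
    obtain ⟨x, hxS, hxF⟩ := hS
    exact Matrix.det_eq_zero_of_row_eq_zero ⟨x, hxS⟩ fun y => hsupp x y hxF

/-- The extended determinant of `1 + A` is the limit of the determinants of its finite
truncations. -/
theorem IsHilbertSchmidt.tendsto_det_compress {A : L2 ι →L[ℂ] L2 ι} (hA : IsHilbertSchmidt A)
    (hdiag : Summable fun x => kernel A x x) :
    Tendsto (fun F : Finset ι => (1 + compress F A).det) atTop
      (𝓝 (fredholmDet (regPart A) * Complex.exp (∑' x, kernel A x x))) := by
  have h1 : Tendsto (fun F : Finset ι => Complex.exp (∑ x ∈ F, kernel A x x)) atTop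
      (𝓝 (Complex.exp (∑' x, kernel A x x))) :=
    (Complex.continuous_exp.tendsto _).comp hdiag.hasSum
  refine (hA.tendsto_fredholmDet_regPart.mul h1).congr fun F => ?_
  rw [fredholmDet_regPart_block, mul_assoc, ← Complex.exp_add, neg_add_cancel, Complex.exp_zero,
    mul_one]

end Determinants


/-! ### Multiplicative functionals of determinantal measures -/

section Probability

open Filter Topology

variable {ι : Type}

theorem measurableSet_subset_conf (S : Finset ι) :
    MeasurableSet {X : Conf ι | (S : Set ι) ⊆ X} := by
  have h : {X : Conf ι | (S : Set ι) ⊆ X} = ⋂ x ∈ S, {X : Conf ι | x ∈ X} := by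
    ext X
    simp [Set.subset_def]
  rw [h]
  exact S.measurableSet_biInter fun x _ => measurable_set_mem x |>.setOf

/-- The summand of index `S` in the expansion of `∏_{x ∈ X} (1 + f x)` over the finite subsets of
`X`. It is zero unless `S ⊆ X`. -/
def phiTerm (f : ι → ℂ) (S : Finset ι) : Conf ι → ℂ :=
  Set.indicator {X | (S : Set ι) ⊆ X} fun _ => ∏ x ∈ S, f x

theorem phiTerm_eq_prod (f : ι → ℂ) (S : Finset ι) (X : Conf ι) :
    phiTerm f S X = ∏ x ∈ S, Set.indicator X f x := by
  classical
  by_cases h : (S : Set ι) ⊆ X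
  · rw [phiTerm, Set.indicator_of_mem (by exact h)]
    exact Finset.prod_congr rfl fun x hx => (Set.indicator_of_mem (h hx) f).symm
  · rw [phiTerm, Set.indicator_of_notMem (by exact h)]
    obtain ⟨x, hxS, hxX⟩ := Set.not_subset.1 h
    exact (Finset.prod_eq_zero (Finset.mem_coe.1 hxS) (Set.indicator_of_notMem hxX f)).symm

theorem Phi_eq_tsum {f : ι → ℂ} {X : Conf ι} (hX : PhiDefinedAt f X) :
    Phi f X = ∑' S, phiTerm f S X := by
  classical
  have h1 : Summable fun x => ‖Set.indicator X f x‖ := by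
    have h := (summable_subtype_iff_indicator (f := fun x => ‖f x‖) (s := X)).1 hX
    refine h.congr fun x => ?_
    rw [norm_indicator_eq_indicator_norm]
  simp only [phiTerm_eq_prod]
  rw [← tprod_one_add (summable_finsetProd_of_summable_norm h1), Phi,
    tprod_subtype X fun x => 1 + f x]
  refine tprod_congr fun x => ?_
  by_cases hx : x ∈ X <;> simp [hx]

section Measure

variable {P : Measure (Conf ι)}

theorem integrable_phiTerm [IsProbabilityMeasure P] (f : ι → ℂ) (S : Finset ι) :
    Integrable (phiTerm f S) P :=
  (integrable_const _).indicator (measurableSet_subset_conf S)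

theorem integral_phiTerm (f : ι → ℂ) (S : Finset ι) :
    ∫ X, phiTerm f S X ∂P = (∏ x ∈ S, f x) * (P.real {X | (S : Set ι) ⊆ X} : ℂ) := by
  rw [phiTerm, integral_indicator_const _ (measurableSet_subset_conf S), mul_comm]
  exact Complex.real_smul

theorem integral_norm_phiTerm (f : ι → ℂ) (S : Finset ι) :
    ∫ X, ‖phiTerm f S X‖ ∂P = (∏ x ∈ S, ‖f x‖) * P.real {X | (S : Set ι) ⊆ X} := by
  simp only [phiTerm, norm_indicator_eq_indicator_norm, norm_prod]
  rw [integral_indicator_const _ (measurableSet_subset_conf S), mul_comm, smul_eq_mul]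

/-- If the expected absolute values of the terms of the expansion are summable, then the
functional can be integrated term by term. The absolute convergence of the product is read off
from the terms indexed by singletons. -/
theorem integrable_Phi_of_summable [Countable ι] [IsProbabilityMeasure P] {f : ι → ℂ}
    (hf : Summable fun S : Finset ι => (∏ x ∈ S, ‖f x‖) * P.real {X | (S : Set ι) ⊆ X}) :
    (∀ᵐ X ∂P, PhiDefinedAt f X) ∧ Integrable (Phi f) P ∧
      HasSum (fun S : Finset ι => (∏ x ∈ S, f x) * (P.real {X | (S : Set ι) ⊆ X} : ℂ))
        (∫ X, Phi f X ∂P) := by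
  simp only [← integral_norm_phiTerm] at hf
  have hmeas : ∀ S, AEMeasurable (fun X => ‖phiTerm f S X‖ₑ) P := fun S =>
    (integrable_phiTerm f S).aestronglyMeasurable.enorm
  have hfin : ∫⁻ X, ∑' S, ‖phiTerm f S X‖ₑ ∂P ≠ ⊤ := by
    rw [lintegral_tsum hmeas]
    have h1 : ∀ S, ∫⁻ X, ‖phiTerm f S X‖ₑ ∂P = ENNReal.ofReal (∫ X, ‖phiTerm f S X‖ ∂P) :=
      fun S => (ofReal_integral_norm_eq_lintegral_enorm (integrable_phiTerm f S)).symm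
    simp only [h1]
    exact hf.tsum_ofReal_ne_top
  have hae : ∀ᵐ X ∂P, Summable fun S => ‖phiTerm f S X‖ := by
    filter_upwards [ae_lt_top' (AEMeasurable.tsum hmeas) hfin] with X hX
    have h2 := ENNReal.summable_toReal hX.ne
    simpa using h2
  have hdef : ∀ᵐ X ∂P, PhiDefinedAt f X := by
    filter_upwards [hae] with X hX
    have h3 : Function.Injective fun x : X => ({(x : ι)} : Finset ι) := fun x y h =>
      Subtype.ext (Finset.singleton_injective h)
    refine (hX.comp_injective h3).congr fun x => ?_
    rw [Function.comp_apply, phiTerm_eq_prod, Finset.prod_singleton, Set.indicator_of_mem x.2]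
  have hPhi : ∀ᵐ X ∂P, Phi f X = ∑' S, phiTerm f S X := by
    filter_upwards [hdef] with X hX using Phi_eq_tsum hX
  refine ⟨hdef, ?_, ?_⟩
  · refine Integrable.congr ?_ (hPhi.mono fun X hX => hX.symm)
    refine ⟨?_, ?_⟩
    · have hm : Measurable fun X => ∑' S, phiTerm f S X := by
        exact Measurable.tsum fun S => measurable_const.indicator (measurableSet_subset_conf S)
      exact hm.aestronglyMeasurable
    · refine lt_of_le_of_lt (lintegral_mono_ae ?_) hfin.lt_top
      filter_upwards [hae] with X hX
      exact enorm_tsum_le_tsum_enorm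
  · have h4 := hasSum_integral_of_summable_integral_norm (integrable_phiTerm f) hf
    rw [← integral_congr_ae hPhi] at h4
    simpa only [integral_phiTerm] using h4

end Measure

theorem tendsto_powerset_atTop :
    Tendsto (fun F : Finset ι => F.powerset) atTop atTop := by
  classical
  refine tendsto_atTop.2 fun 𝒮 => ?_
  filter_upwards [eventually_ge_atTop (𝒮.biUnion id)] with F hF S hS
  exact Finset.mem_powerset.2 ((Finset.subset_biUnion_of_mem id hS).trans hF)

variable [DecidableEq ι]

theorem kernel_mulOp_mul (g : ι → ℂ) (hg : ∃ C : ℝ, ∀ x, ‖g x‖ ≤ C) (B : L2 ι →L[ℂ] L2 ι)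
    (x y : ι) : kernel (mulOp g hg * B) x y = g x * kernel B x y := rfl

section Determinantal

variable {P : Measure (Conf ι)} {K B : L2 ι →L[ℂ] L2 ι} {f g : ι → ℂ} {h : ι → ℝ}

/-- The principal minors of `A_g A_h K A_h` are the probabilities of `S ⊆ X` weighted by
`∏_{x ∈ S} f x`. -/
theorem minor_mulOp_mul (hP : IsDeterminantal P K) (hf : ∀ x, f x = g x * (h x : ℂ) ^ 2)
    (hg : ∃ C : ℝ, ∀ x, ‖g x‖ ≤ C) (hB : IsSandwich h K B) (S : Finset ι) :
    (Matrix.of fun x y : S => kernel (mulOp g hg * B) x y).det =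
      (∏ x ∈ S, f x) * (P.real {X | (S : Set ι) ⊆ X} : ℂ) := by
  have h1 : (Matrix.of fun x y : S => kernel (mulOp g hg * B) x y) =
      Matrix.of fun x y : S => (g x * h x) *
        Matrix.of (fun x y : S => (h y : ℂ) * Matrix.of (fun x y : S => kernel K x y) x y) x y := by
    ext x y
    simp only [Matrix.of_apply]
    rw [kernel_mulOp_mul, hB]
    ring
  rw [h1, Matrix.det_mul_column, Matrix.det_mul_row, ← hP S, ← mul_assoc,
    ← Finset.prod_mul_distrib, ← Finset.prod_coe_sort S]
  congr 1
  refine Finset.prod_congr rfl fun x _ => ?_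
  rw [hf]
  ring

theorem IsHilbertSchmidt.tendsto_sum_minors (hBHS : IsHilbertSchmidt B)
    (hdiag : Summable fun x => ‖kernel B x x‖) (hP : IsDeterminantal P K)
    (hf : ∀ x, f x = g x * (h x : ℂ) ^ 2) (hg : ∃ C : ℝ, ∀ x, ‖g x‖ ≤ C)
    (hB : IsSandwich h K B) :
    Tendsto (fun F : Finset ι =>
        ∑ S ∈ F.powerset, (∏ x ∈ S, f x) * (P.real {X | (S : Set ι) ⊆ X} : ℂ)) atTop
      (𝓝 (fredholmDet (regPart (mulOp g hg * B)) *
        Complex.exp (∑' x, kernel (mulOp g hg * B) x x))) := by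
  have hdiag' : Summable fun x => kernel (mulOp g hg * B) x x := by
    obtain ⟨C, hC⟩ := hg
    refine Summable.of_norm_bounded (hdiag.mul_left C) fun x => ?_
    rw [kernel_mulOp_mul, norm_mul]
    gcongr
    exact hC x
  refine ((hBHS.mul_left (mulOp g hg)).tendsto_det_compress hdiag').congr fun F => ?_
  simp only [← minor_mulOp_mul hP hf hg hB]
  rw [sum_powerset_minors, compress_apply]

/-- The identity for the expectation over a general countable set: only the Hilbert–Schmidt
property and the summable diagonal of `A_h K A_h` matter. -/
theorem IsDeterminantal.integral_Phi [Countable ι] [IsProbabilityMeasure P]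
    (hP : IsDeterminantal P K) (hf : ∀ x, f x = g x * (h x : ℂ) ^ 2)
    (hg : ∃ C : ℝ, ∀ x, ‖g x‖ ≤ C) (hB : IsSandwich h K B) (hBHS : IsHilbertSchmidt B)
    (hdiag : Summable fun x => ‖kernel B x x‖) :
    (∀ᵐ X ∂P, PhiDefinedAt f X) ∧ Integrable (Phi f) P ∧
      ∫ X, Phi f X ∂P = fredholmDet (regPart (mulOp g hg * B)) *
        Complex.exp (∑' x, kernel (mulOp g hg * B) x x) := by
  have hsum : Summable fun S : Finset ι => (∏ x ∈ S, ‖f x‖) * P.real {X | (S : Set ι) ⊆ X} := by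
    -- The same limit for `|f| = |g| h²` bounds the partial sums of these nonnegative terms.
    have hg' : ∃ C : ℝ, ∀ x, ‖((‖g x‖ : ℝ) : ℂ)‖ ≤ C := by simpa using hg
    have hf' : ∀ x, ((‖f x‖ : ℝ) : ℂ) = ((‖g x‖ : ℝ) : ℂ) * (h x : ℂ) ^ 2 := fun x => by
      rw [hf, norm_mul, norm_pow, Complex.norm_real, Real.norm_eq_abs, sq_abs]
      push_cast
      rfl
    have hlim := (hBHS.tendsto_sum_minors hdiag hP hf' hg' hB).norm
    have hmono : Monotone fun F : Finset ι =>
        ∑ S ∈ F.powerset, (∏ x ∈ S, ‖f x‖) * P.real {X | (S : Set ι) ⊆ X} := fun F G hFG =>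
      Finset.sum_le_sum_of_subset_of_nonneg (Finset.powerset_mono.2 hFG)
        fun S _ _ => by positivity
    have hlim' := hlim.congr fun F => by
      rw [show (∑ S ∈ F.powerset, (∏ x ∈ S, ((‖f x‖ : ℝ) : ℂ)) *
          (P.real {X | (S : Set ι) ⊆ X} : ℂ)) = ((∑ S ∈ F.powerset, (∏ x ∈ S, ‖f x‖) *
            P.real {X | (S : Set ι) ⊆ X} : ℝ) : ℂ) by push_cast; rfl, Complex.norm_real,
        Real.norm_of_nonneg (Finset.sum_nonneg fun S _ => by positivity)]
    refine summable_of_sum_le (fun S => by positivity) fun 𝒮 =>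
      le_trans ?_ (hmono.ge_of_tendsto hlim' (𝒮.biUnion id))
    exact Finset.sum_le_sum_of_subset_of_nonneg
      (fun S hS => Finset.mem_powerset.2 (Finset.subset_biUnion_of_mem id hS))
      fun S _ _ => by positivity
  obtain ⟨h1, h2, h3⟩ := integrable_Phi_of_summable hsum
  exact ⟨h1, h2, tendsto_nhds_unique (h3.comp tendsto_powerset_atTop)
    (hBHS.tendsto_sum_minors hdiag hP hf hg hB)⟩

end Determinantal

end Probability

/-! ### The class `𝓛(H)` -/

section Half

theorem mem_posHalf_or_mem_negHalf (x : HalfInt) : x ∈ posHalf ∨ x ∈ negHalf := by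
  obtain ⟨q, n, rfl⟩ := x
  rcases le_or_gt 0 n with hn | hn
  · left
    have : (0 : ℚ) ≤ n := by exact_mod_cast hn
    change (0 : ℚ) < n + 1 / 2
    linarith
  · right
    have : (n : ℚ) ≤ -1 := by exact_mod_cast (by omega : n ≤ -1)
    change (n : ℚ) + 1 / 2 < 0
    linarith

theorem notMem_negHalf {x : HalfInt} (hx : x ∈ posHalf) : x ∉ negHalf := fun h =>
  lt_asymm (show (0 : ℚ) < x.1 from hx) h

theorem proj_posHalf_add_proj_negHalf : (proj posHalf + proj negHalf : H →L[ℂ] H) = 1 := by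
  classical
  ext v x
  change proj posHalf v x + proj negHalf v x = v x
  rw [proj_apply, proj_apply]
  rcases mem_posHalf_or_mem_negHalf x with hx | hx
  · simp [hx, notMem_negHalf hx]
  · have hx' : x ∉ posHalf := fun h => notMem_negHalf h hx
    simp [hx, hx']

theorem sum_blocks (A : H →L[ℂ] H) :
    A = block posHalf posHalf A + block negHalf negHalf A +
      (block posHalf negHalf A + block negHalf posHalf A) := by
  have h : A = (proj posHalf + proj negHalf) * A * (proj posHalf + proj negHalf) := by
    rw [proj_posHalf_add_proj_negHalf, one_mul, mul_one]
  conv_lhs => rw [h]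
  simp only [block]
  noncomm_ring

theorem MemLL.isHilbertSchmidt {B : H →L[ℂ] H} (hB : MemLL B) : IsHilbertSchmidt B := by
  rw [sum_blocks B]
  exact (hB.pos_pos.isHilbertSchmidt.add hB.neg_neg.isHilbertSchmidt).add
    (hB.pos_neg.add hB.neg_pos)

theorem kernel_diag_eq_add (A : H →L[ℂ] H) (x : HalfInt) :
    kernel A x x = kernel (block posHalf posHalf A) x x + kernel (block negHalf negHalf A) x x := by
  classical
  rw [kernel_block, kernel_block]
  rcases mem_posHalf_or_mem_negHalf x with hx | hx
  · simp [hx, notMem_negHalf hx]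
  · have hx' : x ∉ posHalf := fun h => notMem_negHalf h hx
    simp [hx, hx']

theorem MemLL.summable_diag {B : H →L[ℂ] H} (hB : MemLL B) :
    Summable fun x => ‖kernel B x x‖ := by
  refine (hB.pos_pos.summable_diag.add hB.neg_neg.summable_diag).of_nonneg_of_le
    (fun x => norm_nonneg _) fun x => ?_
  rw [kernel_diag_eq_add]
  exact norm_add_le _ _

/-- When the diagonal is summable, the exponent in the extended determinant is the sum of the
diagonal. -/
theorem detOneAdd_eq {A : H →L[ℂ] H} (hA : Summable fun x => ‖kernel A x x‖) :
    detOneAdd A = fredholmDet (regPart A) * Complex.exp (∑' x, kernel A x x) := by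
  classical
  have hsum : ∀ Y : Set HalfInt, Summable fun x => kernel (block Y Y A) x x := fun Y => by
    refine Summable.of_norm_bounded hA fun x => ?_
    rw [kernel_block]
    split_ifs
    · exact le_rfl
    · simp
  simp only [kernel_diag_eq_add A]
  rw [(hsum posHalf).tsum_add (hsum negHalf)]
  rfl

end Half

end

end DetMeasure

theorem proposition2p7
    (P : MeasureTheory.Measure (DetMeasure.Conf DetMeasure.HalfInt))
    [MeasureTheory.IsProbabilityMeasure P]
    (K : DetMeasure.H →L[ℂ] DetMeasure.H)
    (hP : DetMeasure.IsDeterminantal P K)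
    (f g : DetMeasure.HalfInt → ℂ) (h : DetMeasure.HalfInt → ℝ)
    (hf : ∀ x, f x = g x * (h x : ℂ) ^ 2)
    (hg : ∃ C : ℝ, ∀ x, ‖g x‖ ≤ C)
    (hh : ∀ x, 0 ≤ h x)
    (B : DetMeasure.H →L[ℂ] DetMeasure.H)
    (hB : DetMeasure.IsSandwich h K B)
    (hBLL : DetMeasure.MemLL B) :
    (∀ᵐ X ∂P, DetMeasure.PhiDefinedAt f X) ∧
      MeasureTheory.Integrable (DetMeasure.Phi f) P ∧
      ∫ X, DetMeasure.Phi f X ∂P =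
        DetMeasure.detOneAdd (DetMeasure.mulOp g hg * B) := by
  have hdiag : Summable fun x => ‖DetMeasure.kernel (DetMeasure.mulOp g hg * B) x x‖ := by
    obtain ⟨C, hC⟩ := id hg
    refine (hBLL.summable_diag.mul_left C).of_nonneg_of_le (fun x => norm_nonneg _) fun x => ?_
    rw [DetMeasure.kernel_mulOp_mul, norm_mul]
    gcongr
    exact hC x
  rw [DetMeasure.detOneAdd_eq hdiag]
  exact hP.integral_Phi hf hg hB hBLL.isHilbertSchmidt hBLL.summable_diag
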